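/- Let $A$ be a von Neumann algebra acting on a complex Hilbert space and let $A_{sa}$ be its set of self-adjoint elements. For $a\in A_{sa}$ let $(e^a_x)_{x\in\mathbb{R}}$, $e^a_x=\chi_{(-\infty,x]}(a)$, be the spectral resolution of $a$, and let $\leq_s$ be the spectral order on $A_{sa}$: $a\leq_s b$ if and only if $e^a_x\geq e^b_x$ for all $x\in\mathbb{R}$. A context of $A$ is an abelian von Neumann subalgebra $C\subseteq A$ (containing the unit of $A$); write $C_{sa}=C\cap A_{sa}$. For $a\in A_{sa}$ and a context $C$ the outer and inner daseinisation of $a$ in $C$ are $$\delta^{o}(a)_{C}:=\bigwedge\{b\in C_{sa}\mid a\leq_{s}b\},\qquad \delta^{i}(a)_{C}:=\bigvee\{b\in C_{sa}\mid b\leq_{s}a\},$$ where the meet and the join are taken in $A_{sa}$ with respect to the spectral order. Corollary 5.16. Let $h:A\to A$ be a $*$-automorphism, $a\in A_{sa}$ and $C$ a context of $A$. Then $h[C]$ is a context of $A$, the meets and joins defining $\delta^{o}(a)_{C}$, $\delta^{i}(a)_{C}$, $\delta^{o}(h(a))_{h[C]}$ and $\delta^{i}(h(a))_{h[C]}$ exist,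 the first two lie in $C_{sa}$ and the last two in $h[C]_{sa}$, and $$h(\delta^{o}(a)_{C})=\delta^{o}(h(a))_{h[C]},\qquad h(\delta^{i}(a)_{C})=\delta^{i}(h(a))_{h[C]}.$$ -/

import Mathlib

/-- The projection `e^a_x = χ_{(-∞, x]}(a)` of the spectral resolution of a bounded self-adjoint
operator `a`: the orthogonal projection onto the kernel of the positive part `(a - x)⁺`, which is
obtained from `a` by the continuous functional calculus for `t ↦ max (t - x) 0`. -/
noncomputable def spectralProjection {H : Type*} [NormedAddCommGroup H] [InnerProductSpace ℂ H]
    [CompleteSpace H] (a : H →L[ℂ] H) (x : ℝ) : H →L[ℂ] H :=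
  (cfc (fun t : ℝ => max (t - x) 0) a).ker.starProjection

/-- The set `A_sa` of self-adjoint elements of a von Neumann algebra `A`. -/
@[ext]
structure SelfAdjointPart {H : Type*} [NormedAddCommGroup H] [InnerProductSpace ℂ H]
    [CompleteSpace H] (A : VonNeumannAlgebra H) where
  /-- the underlying bounded operator -/
  val : H →L[ℂ] H
  mem : val ∈ A
  isSelfAdjoint : IsSelfAdjoint val

/-- The spectral order on `A_sa`: `a ≤ b` means `e^b_x ≤ e^a_x` for every real `x`, where
projections are compared in the usual operator order. -/
instance SelfAdjointPart.spectralOrder {H : Type*} [NormedAddCommGroup H]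
    [InnerProductSpace ℂ H] [CompleteSpace H] (A : VonNeumannAlgebra H) :
    Preorder (SelfAdjointPart A) where
  le a b := ∀ x : ℝ, spectralProjection b.val x ≤ spectralProjection a.val x
  le_refl _ _ := le_rfl
  le_trans _ _ _ hab hbc x := (hbc x).trans (hab x)

/-- A context of `A`: an abelian von Neumann subalgebra of `A` (with the same unit). -/
structure Context {H : Type*} [NormedAddCommGroup H] [InnerProductSpace ℂ H]
    [CompleteSpace H] (A : VonNeumannAlgebra H) where
  /-- the underlying von Neumann algebra -/
  algebra : VonNeumannAlgebra H
  le : algebra ≤ A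
  comm : ∀ b ∈ algebra, ∀ c ∈ algebra, b * c = c * b

/-- The set `{b ∈ C_sa | a ≤ₛ b}`. -/
def Context.above {H : Type*} [NormedAddCommGroup H] [InnerProductSpace ℂ H]
    [CompleteSpace H] {A : VonNeumannAlgebra H} (C : Context A) (a : SelfAdjointPart A) :
    Set (SelfAdjointPart A) :=
  {b | b.val ∈ C.algebra ∧ a ≤ b}

/-- The set `{b ∈ C_sa | b ≤ₛ a}`. -/
def Context.below {H : Type*} [NormedAddCommGroup H] [InnerProductSpace ℂ H]
    [CompleteSpace H] {A : VonNeumannAlgebra H} (C : Context A) (a : SelfAdjointPart A) :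
    Set (SelfAdjointPart A) :=
  {b | b.val ∈ C.algebra ∧ b ≤ a}

open Classical in
/-- Outer daseinisation `δᵒ(a)_C = ⋀ {b ∈ C_sa | a ≤ₛ b}`, the meet being that of `A_sa` in the
spectral order (with the value `a` should there be no meet). -/
noncomputable def outerDaseinisation {H : Type*} [NormedAddCommGroup H] [InnerProductSpace ℂ H]
    [CompleteSpace H] {A : VonNeumannAlgebra H} (a : SelfAdjointPart A) (C : Context A) :
    SelfAdjointPart A :=
  if hd : ∃ d, IsGLB (C.above a) d then hd.choose else a

open Classical in
/-- Inner daseinisation `δⁱ(a)_C = ⋁ {b ∈ C_sa | b ≤ₛ a}`, the join being that of `A_sa` in the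
spectral order (with the value `a` should there be no join). -/
noncomputable def innerDaseinisation {H : Type*} [NormedAddCommGroup H] [InnerProductSpace ℂ H]
    [CompleteSpace H] {A : VonNeumannAlgebra H} (a : SelfAdjointPart A) (C : Context A) :
    SelfAdjointPart A :=
  if hd : ∃ d, IsLUB (C.below a) d then hd.choose else a

/-- The action of a `*`-automorphism of `A` on `A_sa`. -/
noncomputable def SelfAdjointPart.map {H : Type*} [NormedAddCommGroup H] [InnerProductSpace ℂ H]
    [CompleteSpace H] {A : VonNeumannAlgebra H}
    (h : A.toStarSubalgebra ≃⋆ₐ[ℂ] A.toStarSubalgebra) (a : SelfAdjointPart A) :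
    SelfAdjointPart A where
  val := h ⟨a.val, a.mem⟩
  mem := (h ⟨a.val, a.mem⟩).2
  isSelfAdjoint := by
    have ha : star (⟨a.val, a.mem⟩ : A.toStarSubalgebra) = ⟨a.val, a.mem⟩ :=
      Subtype.ext a.isSelfAdjoint
    have h1 : star (h ⟨a.val, a.mem⟩) = h ⟨a.val, a.mem⟩ := by rw [← map_star, ha]
    exact congrArg Subtype.val h1

/-!
The projection `e^a_x` generates the right annihilator in `A` of the positive part `(a - x)⁺`.
This description is algebraic, so a `*`-automorphism `h` maps the spectral resolution of `a` to that
of `h(a)` and acts on `A_sa` as an automorphism of the spectral order. It therefore takes meets and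
joins to meets and joins, and what is left is to show that these exist and that `h[C]` is a context.

Existence: the pointwise meet of the spectral families of a bounded subset of `A_sa`, or its
pointwise join made right continuous, is again a spectral family. Riemann sums assemble it into a
self-adjoint operator, which lies in every von Neumann algebra containing the family.

As for `h[C]`, the algebraic description shows that this commutative norm closed `*`-algebra `B`
contains the projections onto common kernels of its subsets. Such a `B` is its own bicommutant:
if `P` is a projection in the bicommutant, `P ξ = ξ` and `P η = 0`, the density theorem yields
`d ∈ B` with `d ξ` close to `ξ` and `d η` close to `0`. Spectral projections of `d* d` turn `d` into
a projection which almost kills `ξ` and almost fixes `η`, and the meet of a sequence of those, with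
summable errors, kills `ξ` and, unless `η = 0`, does not kill `η`. So the range of `P` is the
supremum of the common kernels of the annihilators in `B` of its vectors.
-/

open Filter Topology Finset

section ResolutionOfIdentity

section StarOrderedRing

variable {R : Type*} [Ring R] [StarRing R] [PartialOrder R] [StarOrderedRing R]

theorem mul_le_mul_isStarProjection {a b q : R} (hq : IsStarProjection q) (ha : Commute a q)
    (hb : Commute b q) (hab : a ≤ b) : a * q ≤ b * q := by
  have compress : ∀ {c : R}, Commute c q → star q * c * q = c * q := fun hc => by
    rw [hq.isSelfAdjoint.star_eq, ← hc.eq, mul_assoc, hq.isIdempotentElem.eq]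
  simpa only [compress ha, compress hb] using star_left_conjugate_le_conjugate hab q

end StarOrderedRing

variable {𝒜 : Type*} [CStarAlgebra 𝒜] [PartialOrder 𝒜] [StarOrderedRing 𝒜]

theorem norm_le_of_neg_algebraMap_le_of_le_algebraMap {a : 𝒜} {r : ℝ} (ha : IsSelfAdjoint a)
    (h₁ : -algebraMap ℝ 𝒜 r ≤ a) (h₂ : a ≤ algebraMap ℝ 𝒜 r) (hr : 0 ≤ r) : ‖a‖ ≤ r := by
  cases subsingleton_or_nontrivial 𝒜
  · simpa [Subsingleton.elim a 0] using hr
  rw [← map_neg, algebraMap_le_iff_le_spectrum] at h₁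
  rw [le_algebraMap_iff_spectrum_le] at h₂
  rcases CStarAlgebra.norm_or_neg_norm_mem_spectrum ha with h | h
  · exact h₂ _ h
  · exact neg_le_neg_iff.1 (h₁ _ h)

theorem eq_zero_of_smul_le_smul {q : 𝒜} (hq : 0 ≤ q) {x y : ℝ} (hxy : x < y)
    (h : y • q ≤ x • q) : q = 0 := by
  have h' : (y - x) • q ≤ (y - x) • 0 := by rwa [smul_zero, sub_smul, sub_nonpos]
  exact le_antisymm (le_of_smul_le_smul_left h' (sub_pos.2 hxy)) hq

/-- A bounded resolution of the identity: an increasing family of projections which is `0` at `m`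
and `1` at `M`. No continuity is required. -/
structure IsResolutionOfIdentity (p : ℝ → 𝒜) (m M : ℝ) : Prop where
  le : m ≤ M
  isStarProjection (x : ℝ) : IsStarProjection (p x)
  monotone : Monotone p
  eq_zero : p m = 0
  eq_one : p M = 1

/-- `p x` commutes with `T` and separates the part of `T` below `x` from the part above `x`, up to
an error `δ`. For `δ = 0` this says that `T` is the spectral integral `∫ x dp`; the step functions
approximating that integral satisfy it with `δ` the mesh of the partition. -/
structure SeparatesWithin (δ : ℝ) (p : ℝ → 𝒜) (T : 𝒜) : Prop where
  commute (x : ℝ) : Commute T (p x)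
  mul_le (x : ℝ) : T * p x ≤ (x + δ) • p x
  le_mul (x : ℝ) : (x - δ) • (1 - p x) ≤ T * (1 - p x)

/-- The `k`-th point of the partition of `[m, M]` into `n + 1` intervals of equal length. -/
noncomputable def partitionPoint (m M : ℝ) (n k : ℕ) : ℝ := m + k * ((M - m) / (n + 1))

/-- The spectral projection of the `k`-th interval of the partition of `[m, M]` into `n + 1`
intervals of equal length. -/
noncomputable def spectralIncrement (p : ℝ → 𝒜) (m M : ℝ) (n k : ℕ) : 𝒜 :=
  p (partitionPoint m M n (k + 1)) - p (partitionPoint m M n k)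

/-- The lower Riemann sum of the spectral integral `∫ x dp` over `n + 1` intervals. -/
noncomputable def spectralSum (p : ℝ → 𝒜) (m M : ℝ) (n : ℕ) : 𝒜 :=
  ∑ k ∈ range (n + 1), partitionPoint m M n k • spectralIncrement p m M n k

theorem partitionPoint_zero (m M : ℝ) (n : ℕ) : partitionPoint m M n 0 = m := by
  simp [partitionPoint]

theorem partitionPoint_last (m M : ℝ) (n : ℕ) : partitionPoint m M n (n + 1) = M := by
  unfold partitionPoint
  push_cast
  field_simp
  ring

theorem partitionPoint_succ (m M : ℝ) (n k : ℕ) :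
    partitionPoint m M n (k + 1) = partitionPoint m M n k + (M - m) / (n + 1) := by
  unfold partitionPoint
  push_cast
  ring

theorem monotone_partitionPoint {m M : ℝ} (h : m ≤ M) (n : ℕ) :
    Monotone (partitionPoint m M n) :=
  monotone_nat_of_le_succ fun k => by
    rw [partitionPoint_succ]
    exact le_add_of_nonneg_right (div_nonneg (sub_nonneg.2 h) (by positivity))

theorem tendsto_mesh (m M : ℝ) :
    Tendsto (fun n : ℕ => (M - m) / (n + 1 : ℝ)) atTop (𝓝 0) := by
  simpa [div_eq_mul_one_div (M - m)] using
    tendsto_one_div_add_atTop_nhds_zero_nat.const_mul (M - m)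

namespace IsResolutionOfIdentity

variable {p : ℝ → 𝒜} {m M : ℝ}

theorem mul_eq_left (hp : IsResolutionOfIdentity p m M) {x y : ℝ} (h : x ≤ y) :
    p x * p y = p x :=
  ((hp.isStarProjection x).le_iff_mul_eq_left (hp.isStarProjection y)).1 (hp.monotone h)

theorem mul_eq_right (hp : IsResolutionOfIdentity p m M) {x y : ℝ} (h : x ≤ y) :
    p y * p x = p x :=
  ((hp.isStarProjection x).le_iff_mul_eq_right (hp.isStarProjection y)).1 (hp.monotone h)

theorem commute (hp : IsResolutionOfIdentity p m M) (x y : ℝ) : Commute (p x) (p y) := by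
  rcases le_total x y with h | h
  · exact (hp.mul_eq_left h).trans (hp.mul_eq_right h).symm
  · exact (hp.mul_eq_right h).trans (hp.mul_eq_left h).symm

theorem isStarProjection_spectralIncrement (hp : IsResolutionOfIdentity p m M) (n k : ℕ) :
    IsStarProjection (spectralIncrement p m M n k) :=
  ((hp.isStarProjection _).le_iff_sub (hp.isStarProjection _)).1
    (hp.monotone (monotone_partitionPoint hp.le n k.le_succ))

theorem commute_spectralIncrement (hp : IsResolutionOfIdentity p m M) (n k : ℕ) (x : ℝ) :
    Commute (spectralIncrement p m M n k) (p x) :=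
  (hp.commute _ x).sub_left (hp.commute _ x)

omit [StarOrderedRing 𝒜] in
theorem sum_spectralIncrement (hp : IsResolutionOfIdentity p m M) (n : ℕ) :
    ∑ k ∈ range (n + 1), spectralIncrement p m M n k = 1 := by
  simp only [spectralIncrement]
  rw [sum_range_sub (fun k => p (partitionPoint m M n k)), partitionPoint_zero,
    partitionPoint_last, hp.eq_zero, hp.eq_one, sub_zero]

omit [StarOrderedRing 𝒜] in
theorem sub_spectralSum (hp : IsResolutionOfIdentity p m M) (T : 𝒜) (n : ℕ) :
    T - spectralSum p m M n = ∑ k ∈ range (n + 1),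
      (T * spectralIncrement p m M n k - partitionPoint m M n k • spectralIncrement p m M n k) := by
  rw [sum_sub_distrib, ← mul_sum, hp.sum_spectralIncrement, mul_one, spectralSum]

theorem spectralIncrement_mul_eq_zero (hp : IsResolutionOfIdentity p m M) {n k : ℕ} {x : ℝ}
    (hx : x ≤ partitionPoint m M n k) : spectralIncrement p m M n k * p x = 0 := by
  rw [spectralIncrement, sub_mul, hp.mul_eq_right hx,
    hp.mul_eq_right (hx.trans (monotone_partitionPoint hp.le n k.le_succ)), sub_self]

theorem spectralIncrement_mul_one_sub_eq_zero (hp : IsResolutionOfIdentity p m M) {n k : ℕ}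
    {x : ℝ} (hx : partitionPoint m M n (k + 1) ≤ x) :
    spectralIncrement p m M n k * (1 - p x) = 0 := by
  rw [mul_sub, mul_one, spectralIncrement, sub_mul, hp.mul_eq_left hx,
    hp.mul_eq_left ((monotone_partitionPoint hp.le n k.le_succ).trans hx), sub_self]

theorem commute_spectralSum (hp : IsResolutionOfIdentity p m M) (n : ℕ) (x : ℝ) :
    Commute (spectralSum p m M n) (p x) :=
  Commute.sum_left _ _ _ fun k _ => (hp.commute_spectralIncrement n k x).smul_left _

theorem spectralSum_mul_le (hp : IsResolutionOfIdentity p m M) (n : ℕ) (x : ℝ) :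
    spectralSum p m M n * p x ≤ x • p x := by
  calc spectralSum p m M n * p x
      ≤ ∑ k ∈ range (n + 1), x • spectralIncrement p m M n k * p x := by
        rw [spectralSum, sum_mul]
        refine sum_le_sum fun k _ => ?_
        have hcomm (c : ℝ) := (hp.commute_spectralIncrement n k x).smul_left c
        rcases le_total (partitionPoint m M n k) x with hx | hx
        · exact mul_le_mul_isStarProjection (hp.isStarProjection x) (hcomm _) (hcomm _)
            (smul_le_smul_of_nonneg_right hx (hp.isStarProjection_spectralIncrement n k).nonneg)
        · simp only [smul_mul_assoc, hp.spectralIncrement_mul_eq_zero hx, smul_zero, le_refl]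
    _ = x • p x := by rw [← sum_mul, ← smul_sum, hp.sum_spectralIncrement, smul_one_mul]

theorem le_spectralSum_mul (hp : IsResolutionOfIdentity p m M) (n : ℕ) (x : ℝ) :
    (x - (M - m) / (n + 1)) • (1 - p x) ≤ spectralSum p m M n * (1 - p x) := by
  set t := (M - m) / (n + 1) with ht
  calc (x - t) • (1 - p x)
      = ∑ k ∈ range (n + 1), (x - t) • spectralIncrement p m M n k * (1 - p x) := by
        rw [← sum_mul, ← smul_sum, hp.sum_spectralIncrement, smul_one_mul]
    _ ≤ spectralSum p m M n * (1 - p x) := by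
        rw [spectralSum, sum_mul]
        refine sum_le_sum fun k _ => ?_
        have hcomm (c : ℝ) : Commute (c • spectralIncrement p m M n k) (1 - p x) :=
          ((Commute.one_right _).sub_right (hp.commute_spectralIncrement n k x)).smul_left c
        rcases le_total (partitionPoint m M n (k + 1)) x with hx | hx
        · simp only [smul_mul_assoc, hp.spectralIncrement_mul_one_sub_eq_zero hx, smul_zero,
            le_refl]
        · refine mul_le_mul_isStarProjection (hp.isStarProjection x).one_sub (hcomm _) (hcomm _)
            (smul_le_smul_of_nonneg_right ?_ (hp.isStarProjection_spectralIncrement n k).nonneg)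
          rwa [sub_le_iff_le_add, ht, ← partitionPoint_succ]

theorem separatesWithin_spectralSum (hp : IsResolutionOfIdentity p m M) (n : ℕ) :
    SeparatesWithin ((M - m) / (n + 1)) p (spectralSum p m M n) where
  commute := hp.commute_spectralSum n
  mul_le x := (hp.spectralSum_mul_le n x).trans <| smul_le_smul_of_nonneg_right
    (le_add_of_nonneg_right (div_nonneg (sub_nonneg.2 hp.le) (by positivity)))
    (hp.isStarProjection x).nonneg
  le_mul := hp.le_spectralSum_mul n

end IsResolutionOfIdentity

namespace SeparatesWithin

variable {p q : ℝ → 𝒜} {m M δ : ℝ} {T T' : 𝒜}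

theorem mul_sub_le (hT : SeparatesWithin δ p T) (hp : IsResolutionOfIdentity p m M) {x y : ℝ}
    (h : x ≤ y) : T * (p y - p x) ≤ (y + δ) • (p y - p x) := by
  have hmul : p y * (1 - p x) = p y - p x := by rw [mul_sub, mul_one, hp.mul_eq_right h]
  have hcomm : Commute (p y) (1 - p x) := (Commute.one_right _).sub_right (hp.commute y x)
  have := mul_le_mul_isStarProjection (hp.isStarProjection x).one_sub
    (((Commute.one_right T).sub_right (hT.commute x)).mul_left hcomm) (hcomm.smul_left _)
    (hT.mul_le y)
  rwa [mul_assoc, smul_mul_assoc, hmul] at this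

theorem le_mul_sub (hT : SeparatesWithin δ p T) (hp : IsResolutionOfIdentity p m M) {x y : ℝ}
    (h : x ≤ y) : (x - δ) • (p y - p x) ≤ T * (p y - p x) := by
  have hmul : (1 - p x) * p y = p y - p x := by rw [sub_mul, one_mul, hp.mul_eq_left h]
  have hcomm : Commute (1 - p x) (p y) := (Commute.one_left _).sub_left (hp.commute x y)
  have := mul_le_mul_isStarProjection (hp.isStarProjection y) (hcomm.smul_left _)
    ((hT.commute y).mul_left hcomm) (hT.le_mul x)
  rwa [mul_assoc, smul_mul_assoc, hmul] at this

theorem sub_spectralSum_le (hT : SeparatesWithin δ p T) (hp : IsResolutionOfIdentity p m M)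
    (n : ℕ) : T - spectralSum p m M n ≤ algebraMap ℝ 𝒜 ((M - m) / (n + 1) + δ) := by
  rw [hp.sub_spectralSum, Algebra.algebraMap_eq_smul_one, ← hp.sum_spectralIncrement n, smul_sum]
  refine sum_le_sum fun k _ => ?_
  rw [sub_le_iff_le_add, ← add_smul]
  have hpoint : (M - m) / (n + 1) + δ + partitionPoint m M n k =
      partitionPoint m M n (k + 1) + δ := by
    rw [partitionPoint_succ]
    ring
  rw [hpoint]
  exact hT.mul_sub_le hp (monotone_partitionPoint hp.le n k.le_succ)

theorem le_sub_spectralSum (hT : SeparatesWithin δ p T) (hp : IsResolutionOfIdentity p m M)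
    (n : ℕ) : -algebraMap ℝ 𝒜 δ ≤ T - spectralSum p m M n := by
  rw [hp.sub_spectralSum, Algebra.algebraMap_eq_smul_one, ← hp.sum_spectralIncrement n, smul_sum,
    ← sum_neg_distrib]
  refine sum_le_sum fun k _ => ?_
  rw [le_sub_iff_add_le, ← neg_smul, ← add_smul, neg_add_eq_sub]
  exact hT.le_mul_sub hp (monotone_partitionPoint hp.le n k.le_succ)

theorem norm_sub_spectralSum_le (hT : SeparatesWithin δ p T) (hp : IsResolutionOfIdentity p m M)
    (hδ : 0 ≤ δ) (n : ℕ) : ‖T - spectralSum p m M n‖ ≤ (M - m) / (n + 1) + δ := by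
  have hmesh : 0 ≤ (M - m) / (n + 1 : ℝ) := div_nonneg (sub_nonneg.2 hp.le) (by positivity)
  have hle := hT.le_sub_spectralSum hp n
  have hself : IsSelfAdjoint (T - spectralSum p m M n) := by
    simpa using (IsSelfAdjoint.of_nonneg (sub_nonneg.2 hle)).add
      (IsSelfAdjoint.algebraMap 𝒜 (IsSelfAdjoint.all δ)).neg
  refine norm_le_of_neg_algebraMap_le_of_le_algebraMap hself (le_trans ?_ hle)
    (hT.sub_spectralSum_le hp n) (by positivity)
  exact neg_le_neg (algebraMap_mono 𝒜 (le_add_of_nonneg_left hmesh))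

theorem tendsto_spectralSum (hT : SeparatesWithin 0 p T) (hp : IsResolutionOfIdentity p m M) :
    Tendsto (spectralSum p m M) atTop (𝓝 T) :=
  tendsto_iff_norm_sub_tendsto_zero.2 <| squeeze_zero (fun _ => norm_nonneg _)
    (fun n => by
      simpa [norm_sub_rev] using hT.norm_sub_spectralSum_le hp le_rfl n) (tendsto_mesh m M)

theorem eq (hT : SeparatesWithin 0 p T) (hT' : SeparatesWithin 0 p T')
    (hp : IsResolutionOfIdentity p m M) : T = T' :=
  tendsto_nhds_unique (hT.tendsto_spectralSum hp) (hT'.tendsto_spectralSum hp)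

theorem mem_of_isClosed (hT : SeparatesWithin 0 p T) (hp : IsResolutionOfIdentity p m M)
    {S : Submodule ℝ 𝒜} (hS : IsClosed (S : Set 𝒜)) (hpS : ∀ x, p x ∈ S) : T ∈ S :=
  hS.mem_of_tendsto (hT.tendsto_spectralSum hp) <| .of_forall fun _ =>
    S.sum_mem fun _ _ => S.smul_mem _ (S.sub_mem (hpS _) (hpS _))

theorem of_tendsto {T : ℕ → 𝒜} {δ : ℕ → ℝ} {T₀ : 𝒜} (hT : ∀ n, SeparatesWithin (δ n) p (T n))
    (hδ : Tendsto δ atTop (𝓝 0)) (hlim : Tendsto T atTop (𝓝 T₀)) : SeparatesWithin 0 p T₀ where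
  commute x := tendsto_nhds_unique ((hlim.mul_const (p x)).congr fun n => ((hT n).commute x).eq)
    (hlim.const_mul (p x))
  mul_le x := le_of_tendsto_of_tendsto' (hlim.mul_const (p x))
    ((tendsto_const_nhds.add hδ).smul_const (p x)) fun n => (hT n).mul_le x
  le_mul x := le_of_tendsto_of_tendsto' ((tendsto_const_nhds.sub hδ).smul_const (1 - p x))
    (hlim.mul_const (1 - p x)) fun n => (hT n).le_mul x

theorem isSelfAdjoint (hT : SeparatesWithin 0 p T) (hp : IsResolutionOfIdentity p m M) :
    IsSelfAdjoint T := by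
  have h := hT.mul_le M
  rw [hp.eq_one, mul_one, ← sub_nonneg] at h
  simpa using (((IsSelfAdjoint.all (M + 0)).smul (.one 𝒜)).sub (.of_nonneg h))

theorem le_of_lt (hp : ∀ x, IsStarProjection (p x)) (hq : ∀ x, IsStarProjection (q x))
    (hTp : SeparatesWithin 0 p T) (hTq : SeparatesWithin 0 q T)
    (hcomm : ∀ x y, Commute (q x) (p y)) {x y : ℝ} (hxy : x < y) : q x ≤ p y := by
  have hc : Commute (q x) (1 - p y) := (Commute.one_right _).sub_right (hcomm x y)
  have hr : 0 ≤ q x * (1 - p y) := by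
    simpa using mul_le_mul_isStarProjection (hp y).one_sub (Commute.zero_left _) hc (hq x).nonneg
  -- The compression of `T` to `q x * (1 - p y)` is at most `x` and at least `y`, so it vanishes.
  have hle : T * (q x * (1 - p y)) ≤ x • (q x * (1 - p y)) := by
    simpa [mul_assoc] using mul_le_mul_isStarProjection (hp y).one_sub
      (((Commute.one_right T).sub_right (hTp.commute y)).mul_left hc) (hc.smul_left _)
      (hTq.mul_le x)
  have hge : y • (q x * (1 - p y)) ≤ T * (q x * (1 - p y)) := by
    simpa [mul_assoc, hc.eq] using mul_le_mul_isStarProjection (hq x) (hc.symm.smul_left _)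
      ((hTq.commute x).mul_left hc.symm) (hTp.le_mul y)
  rw [(hq x).le_iff_mul_eq_left (hp y)]
  simpa [mul_sub, sub_eq_zero, eq_comm] using eq_zero_of_smul_le_smul hr hxy (hge.trans hle)

theorem eq_one_of_le_algebraMap (hT : SeparatesWithin 0 p T) {r x : ℝ}
    (hp : IsStarProjection (p x)) (hr : T ≤ algebraMap ℝ 𝒜 r) (hrx : r < x) : p x = 1 := by
  have h := mul_le_mul_isStarProjection hp.one_sub
    ((Commute.one_right T).sub_right (hT.commute x)) (Algebra.commutes r _) hr
  rw [← Algebra.smul_def] at h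
  exact (sub_eq_zero.1 <| eq_zero_of_smul_le_smul hp.one_sub_nonneg hrx <|
    (sub_zero x ▸ hT.le_mul x).trans h).symm

theorem eq_zero_of_algebraMap_le (hT : SeparatesWithin 0 p T) {r x : ℝ}
    (hp : IsStarProjection (p x)) (hr : algebraMap ℝ 𝒜 r ≤ T) (hxr : x < r) : p x = 0 := by
  have h := mul_le_mul_isStarProjection hp (Algebra.commutes r _) (hT.commute x) hr
  rw [← Algebra.smul_def] at h
  have h' := hT.mul_le x
  rw [add_zero] at h'
  exact eq_zero_of_smul_le_smul hp.nonneg hxr (h.trans h')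

end SeparatesWithin

theorem IsResolutionOfIdentity.exists_separatesWithin_zero {p : ℝ → 𝒜} {m M : ℝ}
    (hp : IsResolutionOfIdentity p m M) : ∃ T : 𝒜, SeparatesWithin 0 p T := by
  let t (n : ℕ) : ℝ := (M - m) / (n + 1)
  have hmesh_nonneg (n : ℕ) : 0 ≤ t n := div_nonneg (sub_nonneg.2 hp.le) (by positivity)
  have hmesh_anti : Antitone t := fun k n hkn =>
    div_le_div_of_nonneg_left (sub_nonneg.2 hp.le) (by positivity) (by gcongr)
  have hcauchy : CauchySeq (spectralSum p m M) := by
    refine cauchySeq_of_le_tendsto_0 (fun n => t n + t n) (fun k l n hk hl => ?_)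
      (by simpa using (tendsto_mesh m M).add (tendsto_mesh m M))
    rw [dist_eq_norm]
    exact ((hp.separatesWithin_spectralSum k).norm_sub_spectralSum_le hp (hmesh_nonneg k) l).trans
      (add_le_add (hmesh_anti hl) (hmesh_anti hk))
  obtain ⟨T, hT⟩ := cauchySeq_tendsto_of_complete hcauchy
  exact ⟨T, .of_tendsto hp.separatesWithin_spectralSum (tendsto_mesh m M) hT⟩

end ResolutionOfIdentity

section AnnihilatorProjection

variable {R R' : Type*} [Ring R] [StarRing R] [Ring R'] [StarRing R']

theorem commute_of_mul_mul_eq_mul {c p : R} (hp : IsStarProjection p) (h : p * (c * p) = c * p)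
    (h' : p * (star c * p) = star c * p) : Commute c p := by
  have h'' := congr_arg star h'
  simp only [star_mul, star_star, hp.isSelfAdjoint.star_eq] at h''
  rw [Commute, SemiconjBy, ← h'', mul_assoc, h]

/-- The projection `p` generates the right annihilator of `s`: an element is killed by all of `s`
exactly when `p` fixes it. In a Baer `*`-ring, such as a von Neumann algebra, every set has an
annihilator projection, and being defined algebraically it is preserved by `*`-isomorphisms. -/
structure IsAnnihilatorProjection (s : Set R) (p : R) : Prop where
  isStarProjection : IsStarProjection p
  mul_eq_iff (c : R) : p * c = c ↔ ∀ b ∈ s, b * c = 0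

namespace IsAnnihilatorProjection

variable {s : Set R} {p q : R}

theorem mul_eq_zero (hp : IsAnnihilatorProjection s p) {b : R} (hb : b ∈ s) : b * p = 0 :=
  (hp.mul_eq_iff p).1 hp.isStarProjection.isIdempotentElem.eq b hb

theorem eq (hp : IsAnnihilatorProjection s p) (hq : IsAnnihilatorProjection s q) : p = q := by
  have hpq : p * q = q := (hp.mul_eq_iff q).2 fun _ => hq.mul_eq_zero
  have hqp : q * p = p := (hq.mul_eq_iff p).2 fun _ => hp.mul_eq_zero
  have := congr_arg star hqp
  rwa [star_mul, hp.isStarProjection.isSelfAdjoint.star_eq,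
    hq.isStarProjection.isSelfAdjoint.star_eq, hpq, eq_comm] at this

theorem commute (hp : IsAnnihilatorProjection s p) {c : R} (hc : ∀ b ∈ s, Commute b c)
    (hc' : ∀ b ∈ s, Commute b (star c)) : Commute c p := by
  have invariant {d : R} (hd : ∀ b ∈ s, Commute b d) : p * (d * p) = d * p :=
    (hp.mul_eq_iff _).2 fun b hb => by
      rw [← mul_assoc, (hd b hb).eq, mul_assoc, hp.mul_eq_zero hb, mul_zero]
  exact commute_of_mul_mul_eq_mul hp.isStarProjection (invariant hc) (invariant hc')

theorem of_map_injective {F : Type*} [FunLike F R R'] [RingHomClass F R R'] [StarHomClass F R R']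
    {f : F} (hf : Function.Injective f) (hp : IsAnnihilatorProjection (f '' s) (f p)) :
    IsAnnihilatorProjection s p where
  isStarProjection :=
    ⟨hf (by rw [map_mul, hp.isStarProjection.isIdempotentElem.eq]),
      hf (by rw [map_star, hp.isStarProjection.isSelfAdjoint.star_eq])⟩
  mul_eq_iff c := by
    simpa only [← map_mul, Set.forall_mem_image, ← map_zero f, hf.eq_iff] using hp.mul_eq_iff (f c)

theorem map {F : Type*} [EquivLike F R R'] [RingEquivClass F R R'] [StarHomClass F R R'] (e : F)
    (hp : IsAnnihilatorProjection s p) : IsAnnihilatorProjection (e '' s) (e p) where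
  isStarProjection := hp.isStarProjection.map e
  mul_eq_iff c := by
    obtain ⟨d, rfl⟩ := EquivLike.surjective e c
    simpa only [← map_mul, Set.forall_mem_image, ← map_zero e, (EquivLike.injective e).eq_iff]
      using hp.mul_eq_iff d

end IsAnnihilatorProjection

variable {H : Type*} [NormedAddCommGroup H] [InnerProductSpace ℂ H]

/-- The common kernel of a set of bounded operators. -/
noncomputable def commonKernel (s : Set (H →L[ℂ] H)) : ClosedSubmodule ℂ H :=
  ⨅ T ∈ s, (⊥ : ClosedSubmodule ℂ H).comap T

theorem mem_commonKernel {s : Set (H →L[ℂ] H)} {ξ : H} :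
    ξ ∈ commonKernel s ↔ ∀ T ∈ s, T ξ = 0 := by
  simp [commonKernel]

variable [CompleteSpace H]

theorem isAnnihilatorProjection_commonKernel (s : Set (H →L[ℂ] H)) :
    IsAnnihilatorProjection s (commonKernel s).starProjection where
  isStarProjection := isStarProjection_starProjection
  mul_eq_iff c := by
    have h : (commonKernel s).starProjection * c = c ↔ ∀ ξ, c ξ ∈ commonKernel s := by
      rw [ContinuousLinearMap.ext_iff]
      exact forall_congr' fun ξ => Submodule.starProjection_eq_self_iff
    simp only [h, mem_commonKernel, ContinuousLinearMap.ext_iff, mul_apply_eq_comp]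
    exact ⟨fun H b hb ξ => H ξ b hb, fun H ξ b hb => H b hb ξ⟩

theorem isAnnihilatorProjection_mk_commonKernel {B : StarSubalgebra ℂ (H →L[ℂ] H)}
    {s : Set B} (hs : (commonKernel (B.subtype '' s)).starProjection ∈ B) :
    IsAnnihilatorProjection s ⟨_, hs⟩ :=
  .of_map_injective (f := B.subtype) Subtype.val_injective (isAnnihilatorProjection_commonKernel _)

theorem starProjection_orthogonal_mem {B : StarSubalgebra ℂ (H →L[ℂ] H)}
    {K : ClosedSubmodule ℂ H} (hK : K.starProjection ∈ B) : Kᗮ.starProjection ∈ B := by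
  have h : Kᗮ.starProjection = 1 - K.starProjection := K.toSubmodule.starProjection_orthogonal'
  exact h ▸ sub_mem (one_mem B) hK

/-- A `*`-algebra of operators which contains the projections onto the common kernels of its
subsets. Together with norm closedness, this characterizes von Neumann algebras among commutative
algebras. -/
def IsAnnihilatorClosed (B : StarSubalgebra ℂ (H →L[ℂ] H)) : Prop :=
  ∀ s ⊆ (B : Set (H →L[ℂ] H)), (commonKernel s).starProjection ∈ B

theorem isAnnihilatorClosed_vonNeumannAlgebra (A : VonNeumannAlgebra H) :
    IsAnnihilatorClosed A.toStarSubalgebra := by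
  intro s hs
  change _ ∈ A
  rw [← A.commutant_commutant, VonNeumannAlgebra.mem_commutant_iff]
  have hcomm {c : H →L[ℂ] H} (hc : c ∈ A.commutant) (b : H →L[ℂ] H) (hb : b ∈ s) : Commute b c :=
    VonNeumannAlgebra.mem_commutant_iff.1 hc b (hs hb)
  exact fun c hc => (isAnnihilatorProjection_commonKernel s).commute (hcomm hc)
    (hcomm (star_mem hc))

namespace IsAnnihilatorClosed

variable {B : StarSubalgebra ℂ (H →L[ℂ] H)}

theorem starProjection_iInf_mem (hB : IsAnnihilatorClosed B) {ι : Sort*}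
    {K : ι → ClosedSubmodule ℂ H} (hK : ∀ i, (K i).starProjection ∈ B) :
    (⨅ i, K i).starProjection ∈ B := by
  have h : ⨅ i, K i = commonKernel (Set.range fun i => 1 - (K i).starProjection) := by
    ext ξ
    simp [mem_commonKernel, sub_eq_zero, eq_comm (a := ξ), Submodule.starProjection_eq_self_iff]
  rw [h]
  exact hB _ (Set.range_subset_iff.2 fun i => sub_mem (one_mem B) (hK i))

theorem starProjection_iSup_mem (hB : IsAnnihilatorClosed B) {ι : Type*}
    {K : ι → ClosedSubmodule ℂ H} (hK : ∀ i, (K i).starProjection ∈ B) :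
    (⨆ i, K i).starProjection ∈ B := by
  have h : ⨆ i, K i = (⨅ i, (K i)ᗮ)ᗮ := by
    rw [ClosedSubmodule.iInf_orthogonal, ClosedSubmodule.orthogonal_orthogonal_eq]
  rw [h]
  exact starProjection_orthogonal_mem <| hB.starProjection_iInf_mem fun i =>
    starProjection_orthogonal_mem (hK i)

end IsAnnihilatorClosed

end AnnihilatorProjection

section SpectralResolution

variable {𝒜 : Type*} [CStarAlgebra 𝒜]

/-- The spectral resolution of `a` in an abstract `C*`-algebra: `p x` is the annihilator projection
of the positive part `(a - x)⁺`. -/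
def IsSpectralResolution (a : 𝒜) (p : ℝ → 𝒜) : Prop :=
  ∀ x, IsAnnihilatorProjection {cfc (fun t : ℝ => max (t - x) 0) a} (p x)

theorem cfc_max_sub_mul_cfc_max_sub (a : 𝒜) (x : ℝ) :
    cfc (fun t : ℝ => max (t - x) 0) a * cfc (fun t : ℝ => max (x - t) 0) a = 0 := by
  rw [← cfc_mul .., ← cfc_zero ℝ a]
  congr 1
  funext t
  rcases le_total t x with h | h <;> simp [h]

theorem eq_algebraMap_add_cfc_sub_cfc {a : 𝒜} (ha : IsSelfAdjoint a) (x : ℝ) :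
    a = algebraMap ℝ 𝒜 x + cfc (fun t : ℝ => max (t - x) 0) a -
      cfc (fun t : ℝ => max (x - t) 0) a := by
  conv_lhs => rw [← cfc_id ℝ a]
  rw [← cfc_const x a, ← cfc_add .., ← cfc_sub ..]
  congr 1
  funext t
  rcases le_total t x with h | h <;> simp [h]

theorem norm_cfc_max_sub_sub_cfc_max_sub_le (a : 𝒜) (x y : ℝ) :
    ‖cfc (fun t : ℝ => max (t - x) 0) a - cfc (fun t : ℝ => max (t - y) 0) a‖ ≤ |x - y| := by
  rw [← cfc_sub ..]
  refine norm_cfc_le (abs_nonneg _) fun t _ => ?_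
  calc |max (t - x) 0 - max (t - y) 0| ≤ |(t - x) - (t - y)| := abs_max_sub_max_le_abs _ _ _
    _ = |x - y| := by rw [sub_sub_sub_cancel_left, abs_sub_comm]

namespace IsSpectralResolution

variable {a : 𝒜} {p : ℝ → 𝒜}

theorem isStarProjection (hp : IsSpectralResolution a p) (x : ℝ) : IsStarProjection (p x) :=
  (hp x).isStarProjection

theorem commute_of_commute (hp : IsSpectralResolution a p) {b : 𝒜} (hb : IsSelfAdjoint b)
    (hab : Commute a b) (x : ℝ) : Commute b (p x) := by
  have h : Commute (cfc (fun t : ℝ => max (t - x) 0) a) b := hab.cfc_real _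
  exact (hp x).commute (by simpa using h) (by simpa [hb.star_eq] using h)

variable [PartialOrder 𝒜] [StarOrderedRing 𝒜]

theorem separatesWithin_zero (hp : IsSpectralResolution a p) (ha : IsSelfAdjoint a) :
    SeparatesWithin 0 p a := by
  have hpos (x : ℝ) : cfc (fun t : ℝ => max (t - x) 0) a * p x = 0 :=
    (hp x).mul_eq_zero (Set.mem_singleton _)
  have hneg (x : ℝ) : cfc (fun t : ℝ => max (x - t) 0) a * p x =
      cfc (fun t : ℝ => max (x - t) 0) a := by
    have h := ((hp x).mul_eq_iff (cfc (fun t : ℝ => max (x - t) 0) a)).2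
      (by simpa using cfc_max_sub_mul_cfc_max_sub a x)
    simpa [(hp.isStarProjection x).isSelfAdjoint.star_eq,
      (cfc_predicate (fun t : ℝ => max (x - t) 0) a : IsSelfAdjoint _).star_eq]
      using congr_arg star h
  have hmul (x : ℝ) : a * p x = x • p x - cfc (fun t : ℝ => max (x - t) 0) a := by
    conv_lhs => rw [eq_algebraMap_add_cfc_sub_cfc ha x]
    rw [sub_mul, add_mul, hpos, hneg, add_zero, ← Algebra.smul_def]
  refine ⟨hp.commute_of_commute ha (.refl a), fun x => ?_, fun x => ?_⟩
  · rw [hmul, add_zero]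
    exact sub_le_self _ (cfc_nonneg fun t _ => le_max_right _ _)
  · have h : a * (1 - p x) = x • (1 - p x) + cfc (fun t : ℝ => max (t - x) 0) a := by
      rw [mul_sub, hmul, mul_one, smul_sub]
      conv_lhs => enter [1]; rw [eq_algebraMap_add_cfc_sub_cfc ha x]
      rw [Algebra.algebraMap_eq_smul_one]
      abel
    rw [h, sub_zero]
    exact le_add_of_nonneg_right (cfc_nonneg fun t _ => le_max_right _ _)

theorem eq_one_of_norm_lt (hp : IsSpectralResolution a p) (ha : IsSelfAdjoint a) {x : ℝ}
    (hx : ‖a‖ < x) : p x = 1 :=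
  (hp.separatesWithin_zero ha).eq_one_of_le_algebraMap (hp.isStarProjection x)
    ha.le_algebraMap_norm_self hx

theorem eq_zero_of_lt_neg_norm (hp : IsSpectralResolution a p) (ha : IsSelfAdjoint a) {x : ℝ}
    (hx : x < -‖a‖) : p x = 0 :=
  (hp.separatesWithin_zero ha).eq_zero_of_algebraMap_le (hp.isStarProjection x)
    (by simpa using ha.neg_algebraMap_norm_le_self) hx

theorem isResolutionOfIdentity (hp : IsSpectralResolution a p) (ha : IsSelfAdjoint a) :
    IsResolutionOfIdentity p (-(‖a‖ + 1)) (‖a‖ + 1) where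
  le := neg_le_self (by positivity)
  isStarProjection := hp.isStarProjection
  monotone := monotone_iff_forall_lt.2 fun x y hxy =>
    have hT := hp.separatesWithin_zero ha
    hT.le_of_lt hp.isStarProjection hp.isStarProjection hT (fun x y =>
      hp.commute_of_commute (hp.isStarProjection x).isSelfAdjoint (hT.commute x) y) hxy
  eq_zero := hp.eq_zero_of_lt_neg_norm ha (neg_lt_neg (lt_add_one _))
  eq_one := hp.eq_one_of_norm_lt ha (lt_add_one _)

theorem unique (hp : IsSpectralResolution a p) (ha : IsSelfAdjoint a) {b : 𝒜}
    (hb : IsSelfAdjoint b) (hpb : IsSpectralResolution b p) : a = b :=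
  (hp.separatesWithin_zero ha).eq (hpb.separatesWithin_zero hb) (hp.isResolutionOfIdentity ha)

theorem mem_of_isClosed (hp : IsSpectralResolution a p) (ha : IsSelfAdjoint a)
    {S : Submodule ℝ 𝒜} (hS : IsClosed (S : Set 𝒜)) (hpS : ∀ x, p x ∈ S) : a ∈ S :=
  (hp.separatesWithin_zero ha).mem_of_isClosed (hp.isResolutionOfIdentity ha) hS hpS

end IsSpectralResolution

variable {H : Type*} [NormedAddCommGroup H] [InnerProductSpace ℂ H] [CompleteSpace H]

theorem starProjection_le_starProjection_iff {K L : ClosedSubmodule ℂ H} :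
    K.starProjection ≤ L.starProjection ↔ K ≤ L :=
  Submodule.starProjection_le_starProjection_iff.trans ClosedSubmodule.toSubmodule_le_toSubmodule

/-- The closed subspace onto which the spectral projection `e^a_x` projects. -/
noncomputable def spectralSubspace (a : H →L[ℂ] H) (x : ℝ) : ClosedSubmodule ℂ H :=
  commonKernel {cfc (fun t : ℝ => max (t - x) 0) a}

theorem mem_spectralSubspace {a : H →L[ℂ] H} {x : ℝ} {ξ : H} :
    ξ ∈ spectralSubspace a x ↔ cfc (fun t : ℝ => max (t - x) 0) a ξ = 0 := by
  simp [spectralSubspace, mem_commonKernel]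

theorem spectralProjection_eq (a : H →L[ℂ] H) (x : ℝ) :
    spectralProjection a x = (spectralSubspace a x).starProjection :=
  Submodule.starProjection_inj.2 <| Submodule.ext fun _ => mem_spectralSubspace.symm

theorem isSpectralResolution_spectralProjection (a : H →L[ℂ] H) :
    IsSpectralResolution a (spectralProjection a) := fun x => by
  rw [spectralProjection_eq]
  exact isAnnihilatorProjection_commonKernel _

theorem spectralProjection_le_iff {a b : H →L[ℂ] H} {x y : ℝ} :
    spectralProjection a x ≤ spectralProjection b y ↔
      spectralSubspace a x ≤ spectralSubspace b y := by
  rw [spectralProjection_eq, spectralProjection_eq, starProjection_le_starProjection_iff]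

theorem monotone_spectralSubspace {a : H →L[ℂ] H} (ha : IsSelfAdjoint a) :
    Monotone (spectralSubspace a) := fun _ _ hxy =>
  spectralProjection_le_iff.1 <|
    ((isSpectralResolution_spectralProjection a).isResolutionOfIdentity ha).monotone hxy

theorem spectralSubspace_eq_top {a : H →L[ℂ] H} (ha : IsSelfAdjoint a) {x : ℝ} (hx : ‖a‖ < x) :
    spectralSubspace a x = ⊤ := by
  have h := (isSpectralResolution_spectralProjection a).eq_one_of_norm_lt ha hx
  rw [spectralProjection_eq] at h
  refine eq_top_iff.2 fun ξ _ => ?_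
  exact Submodule.starProjection_eq_self_iff.1 (by rw [h, one_apply_eq_self])

theorem spectralSubspace_eq_bot {a : H →L[ℂ] H} (ha : IsSelfAdjoint a) {x : ℝ} (hx : x < -‖a‖) :
    spectralSubspace a x = ⊥ := by
  have h := (isSpectralResolution_spectralProjection a).eq_zero_of_lt_neg_norm ha hx
  rw [spectralProjection_eq] at h
  refine eq_bot_iff.2 fun ξ hξ => ?_
  have := Submodule.starProjection_eq_self_iff.2 hξ
  rw [h] at this
  exact this.symm

theorem iInf_spectralSubspace_le (a : H →L[ℂ] H) (x : ℝ) :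
    ⨅ y : Set.Ioi x, spectralSubspace a y ≤ spectralSubspace a x := by
  intro ξ hξ
  simp only [ClosedSubmodule.mem_iInf, Subtype.forall, Set.mem_Ioi] at hξ
  have hbound (y : ℝ) (hy : x < y) : ‖cfc (fun t : ℝ => max (t - x) 0) a ξ‖ ≤ (y - x) * ‖ξ‖ :=
    calc ‖cfc (fun t : ℝ => max (t - x) 0) a ξ‖
        = ‖(cfc (fun t : ℝ => max (t - x) 0) a - cfc (fun t : ℝ => max (t - y) 0) a) ξ‖ := by
          rw [sub_apply, mem_spectralSubspace.1 (hξ y hy), sub_zero]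
      _ ≤ |x - y| * ‖ξ‖ :=
          ContinuousLinearMap.le_of_opNorm_le _ (norm_cfc_max_sub_sub_cfc_max_sub_le a x y) ξ
      _ = (y - x) * ‖ξ‖ := by rw [abs_sub_comm, abs_of_pos (sub_pos.2 hy)]
  have hlim : Tendsto (fun y => (y - x) * ‖ξ‖) (𝓝[>] x) (𝓝 0) :=
    tendsto_nhdsWithin_of_tendsto_nhds <| Continuous.tendsto' (by fun_prop) _ _ (by simp)
  exact mem_spectralSubspace.2 <| norm_le_zero_iff.1 <|
    ge_of_tendsto hlim (eventually_mem_nhdsWithin.mono hbound)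

theorem spectralSubspace_eq {a : H →L[ℂ] H} (ha : IsSelfAdjoint a) {E : ℝ → ClosedSubmodule ℂ H}
    (hE : ∀ x, ⨅ y : Set.Ioi x, E y ≤ E x)
    (haE : SeparatesWithin 0 (fun x => (E x).starProjection) a) : spectralSubspace a = E := by
  have hs := isSpectralResolution_spectralProjection a
  have hproj (x : ℝ) : IsStarProjection (E x).starProjection := isStarProjection_starProjection
  have hcomm (x y : ℝ) : Commute (E x).starProjection (spectralProjection a y) :=
    hs.commute_of_commute (hproj x).isSelfAdjoint (haE.commute x) y
  have hsep := hs.separatesWithin_zero ha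
  funext x
  refine le_antisymm ((le_iInf fun y => ?_).trans (hE x))
    ((le_iInf fun y => ?_).trans (iInf_spectralSubspace_le a x))
  all_goals rw [← starProjection_le_starProjection_iff, ← spectralProjection_eq]
  · exact haE.le_of_lt hproj hs.isStarProjection hsep (fun x y => (hcomm y x).symm) y.2
  · exact hsep.le_of_lt hs.isStarProjection hproj haE hcomm y.2

theorem exists_spectralSubspace_eq {E : ℝ → ClosedSubmodule ℂ H} {m M : ℝ} (hmM : m ≤ M)
    (hmono : Monotone E) (hE : ∀ x, ⨅ y : Set.Ioi x, E y ≤ E x) (hm : E m = ⊥) (hM : E M = ⊤) :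
    ∃ a : H →L[ℂ] H, IsSelfAdjoint a ∧ spectralSubspace a = E := by
  have hres : IsResolutionOfIdentity (fun x => (E x).starProjection) m M :=
    { le := hmM
      isStarProjection := fun _ => isStarProjection_starProjection
      monotone := fun _ _ hxy => starProjection_le_starProjection_iff.2 (hmono hxy)
      eq_zero := by rw [hm]; exact Submodule.starProjection_bot
      eq_one := by rw [hM]; exact Submodule.starProjection_top' }
  obtain ⟨a, ha⟩ := hres.exists_separatesWithin_zero
  exact ⟨a, ha.isSelfAdjoint hres, spectralSubspace_eq (ha.isSelfAdjoint hres) hE ha⟩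

end SpectralResolution

section RightLimit

variable {α β : Type*} [LinearOrder α] [CompleteLattice β] (G : α → β)

theorem monotone_iInf_Ioi : Monotone fun x : α => ⨅ y : Set.Ioi x, G y := fun x _ hxy =>
  le_iInf fun z => iInf_le (fun y : Set.Ioi x => G y) ⟨z, hxy.trans_lt z.2⟩

theorem iInf_Ioi_iInf_Ioi_le [DenselyOrdered α] (x : α) :
    ⨅ y : Set.Ioi x, ⨅ z : Set.Ioi y.1, G z ≤ ⨅ y : Set.Ioi x, G y := le_iInf fun z => by
  obtain ⟨y, hxy, hyz⟩ := exists_between z.2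
  exact (iInf_le (fun y : Set.Ioi x => ⨅ z : Set.Ioi y.1, G z) ⟨y, hxy⟩).trans
    (iInf_le (fun z : Set.Ioi y => G z) ⟨z, hyz⟩)

end RightLimit

section Completeness

variable {H : Type*} [NormedAddCommGroup H] [InnerProductSpace ℂ H] [CompleteSpace H]

theorem isClosed_vonNeumannAlgebra (A : VonNeumannAlgebra H) : IsClosed (A : Set (H →L[ℂ] H)) := by
  rw [← A.centralizer_centralizer]
  exact Set.isClosed_centralizer _

theorem mem_of_forall_spectralProjection_mem {B : StarSubalgebra ℂ (H →L[ℂ] H)}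
    (hB : IsClosed (B : Set (H →L[ℂ] H))) {a : H →L[ℂ] H} (ha : IsSelfAdjoint a)
    (h : ∀ x, spectralProjection a x ∈ B) : a ∈ B :=
  (isSpectralResolution_spectralProjection a).mem_of_isClosed ha
    (S := B.toSubalgebra.toSubmodule.restrictScalars ℝ) hB h

theorem IsAnnihilatorClosed.spectralProjection_mem {B : StarSubalgebra ℂ (H →L[ℂ] H)}
    (hB : IsAnnihilatorClosed B) (hcl : IsClosed (B : Set (H →L[ℂ] H))) {a : H →L[ℂ] H}
    (ha : a ∈ B) (x : ℝ) : spectralProjection a x ∈ B := by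
  rw [spectralProjection_eq]
  exact hB _ (Set.singleton_subset_iff.2 (cfc_mem (𝕜' := ℂ) _ ha))

theorem spectralProjection_mem_vonNeumannAlgebra {A : VonNeumannAlgebra H} {a : H →L[ℂ] H}
    (ha : a ∈ A) (x : ℝ) : spectralProjection a x ∈ A :=
  (isAnnihilatorClosed_vonNeumannAlgebra A).spectralProjection_mem (isClosed_vonNeumannAlgebra A)
    ha x

variable {A : VonNeumannAlgebra H}

namespace SelfAdjointPart

theorem le_iff {a b : SelfAdjointPart A} :
    a ≤ b ↔ ∀ x, spectralSubspace b.val x ≤ spectralSubspace a.val x :=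
  forall_congr' fun _ => spectralProjection_le_iff

theorem le_of_le_algebraMap_of_algebraMap_le {a b : SelfAdjointPart A} {r s : ℝ}
    (ha : a.val ≤ algebraMap ℝ _ r) (hrs : r < s) (hb : algebraMap ℝ _ s ≤ b.val) : a ≤ b := by
  intro x
  have hpa := isSpectralResolution_spectralProjection a.val
  have hpb := isSpectralResolution_spectralProjection b.val
  rcases lt_or_ge x s with hx | hx
  · rw [(hpb.separatesWithin_zero b.isSelfAdjoint).eq_zero_of_algebraMap_le
      (hpb.isStarProjection x) hb hx]
    exact (hpa.isStarProjection x).nonneg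
  · rw [(hpa.separatesWithin_zero a.isSelfAdjoint).eq_one_of_le_algebraMap
      (hpa.isStarProjection x) ha (hrs.trans_le hx)]
    exact (hpb.isStarProjection x).le_one

instance : PartialOrder (SelfAdjointPart A) where
  le_antisymm a b hab hba := SelfAdjointPart.ext <|
    (isSpectralResolution_spectralProjection a.val).unique a.isSelfAdjoint b.isSelfAdjoint <| by
      rw [show spectralProjection a.val = spectralProjection b.val from
        funext fun x => le_antisymm (hba x) (hab x)]
      exact isSpectralResolution_spectralProjection b.val

/-- The real scalar `r`, as a self-adjoint element of `A`. -/
noncomputable def scalar (A : VonNeumannAlgebra H) (r : ℝ) : SelfAdjointPart A where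
  val := algebraMap ℝ _ r
  mem := by
    rw [Algebra.algebraMap_eq_smul_one, RCLike.real_smul_eq_coe_smul (K := ℂ)]
    exact A.toStarSubalgebra.smul_mem (one_mem A.toStarSubalgebra) _
  isSelfAdjoint := .algebraMap _ (.all r)

theorem le_scalar (a : SelfAdjointPart A) : a ≤ scalar A (‖a.val‖ + 1) :=
  le_of_le_algebraMap_of_algebraMap_le a.isSelfAdjoint.le_algebraMap_norm_self (lt_add_one _) le_rfl

theorem scalar_le (a : SelfAdjointPart A) : scalar A (-(‖a.val‖ + 1)) ≤ a :=
  le_of_le_algebraMap_of_algebraMap_le le_rfl (neg_lt_neg (lt_add_one _))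
    (by simpa using a.isSelfAdjoint.neg_algebraMap_norm_le_self)

theorem exists_spectralSubspace_eq {B : VonNeumannAlgebra H} (hBA : B ≤ A)
    {E : ℝ → ClosedSubmodule ℂ H} {m M : ℝ} (hmM : m ≤ M) (hmono : Monotone E)
    (hE : ∀ x, ⨅ y : Set.Ioi x, E y ≤ E x) (hm : E m = ⊥) (hM : E M = ⊤)
    (hEB : ∀ x, (E x).starProjection ∈ B) :
    ∃ d : SelfAdjointPart A, d.val ∈ B ∧ spectralSubspace d.val = E := by
  obtain ⟨d, hd, rfl⟩ := _root_.exists_spectralSubspace_eq hmM hmono hE hm hM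
  have hdB : d ∈ B := mem_of_forall_spectralProjection_mem (B := B.toStarSubalgebra)
    (isClosed_vonNeumannAlgebra B) hd fun x => by rw [spectralProjection_eq]; exact hEB x
  exact ⟨⟨d, hBA hdB, hd⟩, hdB, rfl⟩

theorem starProjection_spectralSubspace_mem {B : VonNeumannAlgebra H} {b : SelfAdjointPart A}
    (hb : b.val ∈ B) (x : ℝ) : (spectralSubspace b.val x).starProjection ∈ B := by
  rw [← spectralProjection_eq]
  exact spectralProjection_mem_vonNeumannAlgebra hb x

theorem exists_isLUB_mem {B : VonNeumannAlgebra H} (hBA : B ≤ A) {s : Set (SelfAdjointPart A)}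
    (hsB : ∀ b ∈ s, b.val ∈ B) (hne : s.Nonempty) (hs : BddAbove s) :
    ∃ d, IsLUB s d ∧ d.val ∈ B := by
  obtain ⟨b, hb⟩ := hne
  obtain ⟨u, hu⟩ := hs
  let E (x : ℝ) : ClosedSubmodule ℂ H := ⨅ c : s, spectralSubspace c.1.val x
  have hE_le {c : SelfAdjointPart A} (hc : c ∈ s) (x : ℝ) : E x ≤ spectralSubspace c.val x :=
    iInf_le (fun c : s => spectralSubspace c.1.val x) ⟨c, hc⟩
  have le_E {c : SelfAdjointPart A} (hc : c ∈ upperBounds s) (x : ℝ) :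
      spectralSubspace c.val x ≤ E x := le_iInf fun d => le_iff.1 (hc d.2) x
  obtain ⟨d, hdB, hdE⟩ := exists_spectralSubspace_eq hBA (E := E)
    (m := -(‖b.val‖ + 1)) (M := ‖u.val‖ + 1)
    (by linarith [norm_nonneg b.val, norm_nonneg u.val])
    (fun x y hxy => iInf_mono fun c => monotone_spectralSubspace c.1.isSelfAdjoint hxy)
    (fun x => le_iInf fun c => (iInf_mono fun _ => hE_le c.2 _).trans
      (iInf_spectralSubspace_le c.1.val x))
    (eq_bot_iff.2 <| (hE_le hb _).trans_eq <|
      spectralSubspace_eq_bot b.isSelfAdjoint (neg_lt_neg (lt_add_one _)))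
    (eq_top_iff.2 <| (spectralSubspace_eq_top u.isSelfAdjoint (lt_add_one _)).ge.trans (le_E hu _))
    (fun x => (isAnnihilatorClosed_vonNeumannAlgebra B).starProjection_iInf_mem fun c =>
      starProjection_spectralSubspace_mem (hsB c.1 c.2) x)
  refine ⟨d, ⟨fun c hc => le_iff.2 ?_, fun c hc => le_iff.2 ?_⟩, hdB⟩ <;> rw [hdE]
  exacts [hE_le hc, le_E hc]

theorem exists_isGLB_mem {B : VonNeumannAlgebra H} (hBA : B ≤ A) {s : Set (SelfAdjointPart A)}
    (hsB : ∀ b ∈ s, b.val ∈ B) (hne : s.Nonempty) (hs : BddBelow s) :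
    ∃ d, IsGLB s d ∧ d.val ∈ B := by
  obtain ⟨b, hb⟩ := hne
  obtain ⟨l, hl⟩ := hs
  let G (y : ℝ) : ClosedSubmodule ℂ H := ⨆ c : s, spectralSubspace c.1.val y
  -- `G` need not be right continuous, hence the infimum.
  let E (x : ℝ) : ClosedSubmodule ℂ H := ⨅ y : Set.Ioi x, G y
  have le_E {c : SelfAdjointPart A} (hc : c ∈ s) (x : ℝ) : spectralSubspace c.val x ≤ E x :=
    le_iInf fun y => (monotone_spectralSubspace c.isSelfAdjoint y.2.le).trans
      (le_iSup (fun c : s => spectralSubspace c.1.val y) ⟨c, hc⟩)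
  have hG_le {c : SelfAdjointPart A} (hc : c ∈ lowerBounds s) (y : ℝ) :
      G y ≤ spectralSubspace c.val y := iSup_le fun d => le_iff.1 (hc d.2) y
  have hE_le {c : SelfAdjointPart A} (hc : c ∈ lowerBounds s) (x : ℝ) :
      E x ≤ spectralSubspace c.val x :=
    (iInf_mono fun y : Set.Ioi x => hG_le hc y).trans (iInf_spectralSubspace_le c.val x)
  obtain ⟨d, hdB, hdE⟩ := exists_spectralSubspace_eq hBA (E := E)
    (m := -(‖l.val‖ + 1)) (M := ‖b.val‖ + 1)
    (by linarith [norm_nonneg b.val, norm_nonneg l.val])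
    (monotone_iInf_Ioi G) (iInf_Ioi_iInf_Ioi_le G)
    (eq_bot_iff.2 <| (hE_le hl _).trans_eq <|
      spectralSubspace_eq_bot l.isSelfAdjoint (neg_lt_neg (lt_add_one _)))
    (eq_top_iff.2 <| (spectralSubspace_eq_top b.isSelfAdjoint (lt_add_one _)).ge.trans (le_E hb _))
    (fun x => (isAnnihilatorClosed_vonNeumannAlgebra B).starProjection_iInf_mem fun y =>
      (isAnnihilatorClosed_vonNeumannAlgebra B).starProjection_iSup_mem fun c =>
        starProjection_spectralSubspace_mem (hsB c.1 c.2) y)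
  refine ⟨d, ⟨fun c hc => le_iff.2 ?_, fun c hc => le_iff.2 ?_⟩, hdB⟩ <;> rw [hdE]
  exacts [le_E hc, hE_le hc]

end SelfAdjointPart

namespace Context

variable (C : Context A) (a : SelfAdjointPart A)

theorem exists_isGLB_above_mem : ∃ d, IsGLB (C.above a) d ∧ d.val ∈ C.algebra :=
  SelfAdjointPart.exists_isGLB_mem C.le (fun _ hb => hb.1)
    ⟨_, (SelfAdjointPart.scalar C.algebra _).mem, a.le_scalar⟩ ⟨a, fun _ hb => hb.2⟩

theorem exists_isLUB_below_mem : ∃ d, IsLUB (C.below a) d ∧ d.val ∈ C.algebra :=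
  SelfAdjointPart.exists_isLUB_mem C.le (fun _ hb => hb.1)
    ⟨_, (SelfAdjointPart.scalar C.algebra _).mem, a.scalar_le⟩ ⟨a, fun _ hb => hb.2⟩

theorem isGLB_outerDaseinisation : IsGLB (C.above a) (outerDaseinisation a C) := by
  have h : ∃ d, IsGLB (C.above a) d := (C.exists_isGLB_above_mem a).imp fun _ => And.left
  rw [outerDaseinisation, dif_pos h]
  exact h.choose_spec

theorem isLUB_innerDaseinisation : IsLUB (C.below a) (innerDaseinisation a C) := by
  have h : ∃ d, IsLUB (C.below a) d := (C.exists_isLUB_below_mem a).imp fun _ => And.left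
  rw [innerDaseinisation, dif_pos h]
  exact h.choose_spec

theorem outerDaseinisation_mem : (outerDaseinisation a C).val ∈ C.algebra := by
  obtain ⟨d, hd, hdC⟩ := C.exists_isGLB_above_mem a
  exact (C.isGLB_outerDaseinisation a).unique hd ▸ hdC

theorem innerDaseinisation_mem : (innerDaseinisation a C).val ∈ C.algebra := by
  obtain ⟨d, hd, hdC⟩ := C.exists_isLUB_below_mem a
  exact (C.isLUB_innerDaseinisation a).unique hd ▸ hdC

end Context

end Completeness

section Bicommutant

variable {H : Type*} [NormedAddCommGroup H] [InnerProductSpace ℂ H]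

theorem apply_mem_of_commute_starProjection {T : H →L[ℂ] H} {K : Submodule ℂ H}
    [K.HasOrthogonalProjection] (h : Commute T K.starProjection) {ξ : H} (hξ : ξ ∈ K) :
    T ξ ∈ K := by
  rw [← Submodule.starProjection_eq_self_iff, ← mul_apply_eq_comp, ← h.eq, mul_apply_eq_comp,
    Submodule.starProjection_eq_self_iff.2 hξ]

theorem exists_mem_iInf_dist_le {D : ℕ → ClosedSubmodule ℂ H} [CompleteSpace H]
    (hcomm : ∀ m n, Commute (D m).starProjection (D n).starProjection) {η : H}
    (hη : Summable fun n => ‖η - (D n).starProjection η‖) :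
    ∃ w ∈ ⨅ n, D n, dist η w ≤ ∑' n, ‖η - (D n).starProjection η‖ := by
  -- The iterates of the projections applied to `η` converge, as projections are contractions.
  let v (n : ℕ) : H := n.rec η fun k ω => (D k).starProjection ω
  have norm_sub_le (n k : ℕ) :
      ‖v k - (D n).starProjection (v k)‖ ≤ ‖η - (D n).starProjection η‖ := by
    induction k with
    | zero => exact le_rfl
    | succ k ih =>
      have hvk := congr($((hcomm n k).eq) (v k))
      simp only [mul_apply_eq_comp] at hvk
      change ‖(D k).starProjection (v k) - (D n).starProjection ((D k).starProjection (v k))‖ ≤ _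
      rw [hvk, ← map_sub]
      exact (Submodule.norm_starProjection_apply_le _ _).trans ih
  have mem_of_lt {n k : ℕ} (hnk : n < k) : v k ∈ D n := by
    induction k, hnk using Nat.le_induction with
    | base => exact Submodule.starProjection_apply_mem _ _
    | succ k _ ih => exact apply_mem_of_commute_starProjection (hcomm k n) ih
  have hdist (k : ℕ) : dist (v k) (v (k + 1)) ≤ ‖η - (D k).starProjection η‖ := by
    rw [dist_eq_norm]
    exact norm_sub_le k k
  obtain ⟨w, hw⟩ := cauchySeq_tendsto_of_complete (cauchySeq_of_dist_le_of_summable _ hdist hη)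
  refine ⟨w, ClosedSubmodule.mem_iInf.2 fun n => ?_,
    dist_le_tsum_of_dist_le_of_tendsto₀ _ hdist hη hw⟩
  exact (D n).isClosed.mem_of_tendsto hw ((eventually_gt_atTop n).mono fun k => mem_of_lt)

theorem re_inner_le_re_inner_of_le {S T : H →L[ℂ] H} (h : S ≤ T) (ω : H) :
    (inner ℂ (S ω) ω).re ≤ (inner ℂ (T ω) ω).re := by
  have hpos := ((ContinuousLinearMap.le_def _ _).1 h).re_inner_nonneg_left ω
  rwa [sub_apply, inner_sub_left, map_sub, sub_nonneg] at hpos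

theorem re_inner_smul_apply (r : ℝ) {q : H →L[ℂ] H} {ω : H} (hω : q ω = ω) :
    (inner ℂ ((r ^ 2 • q) ω) ω).re = (r * ‖ω‖) ^ 2 := by
  rw [smul_apply, hω, RCLike.real_smul_eq_coe_smul (K := ℂ), inner_smul_real_left, mul_pow,
    ← inner_self_eq_norm_sq (𝕜 := ℂ)]
  exact Complex.re_ofReal_mul _ _

variable [CompleteSpace H]

theorem starProjection_iInf_apply_eq_zero {D : ℕ → ClosedSubmodule ℂ H} {ξ : H}
    (hξ : Tendsto (fun n => (D n).starProjection ξ) atTop (𝓝 0)) :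
    (⨅ n, D n).starProjection ξ = 0 := by
  have hcomp (n : ℕ) : (⨅ n, D n).starProjection ((D n).starProjection ξ) =
      (⨅ n, D n).starProjection ξ :=
    congr($((isStarProjection_starProjection.le_iff_mul_eq_left isStarProjection_starProjection).1
      (starProjection_le_starProjection_iff.2 (iInf_le D n))) ξ)
  have hlim := ((⨅ n, D n).starProjection.continuous.tendsto 0).comp hξ
  rw [map_zero] at hlim
  exact tendsto_nhds_unique (tendsto_const_nhds.congr fun n => (hcomp n).symm) hlim

section SpectralEstimate

variable {d q : H →L[ℂ] H} {r : ℝ} {ω : H}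

theorem re_inner_star_mul_self_mul (hω : q ω = ω) :
    (inner ℂ ((star d * d * q) ω) ω).re = ‖d ω‖ ^ 2 := by
  rw [mul_apply_eq_comp, hω, mul_apply_eq_comp, ContinuousLinearMap.star_eq_adjoint,
    ContinuousLinearMap.adjoint_inner_left]
  exact inner_self_eq_norm_sq (𝕜 := ℂ) _

theorem norm_apply_le_mul_norm (hr : 0 ≤ r) (h : star d * d * q ≤ r ^ 2 • q) (hω : q ω = ω) :
    ‖d ω‖ ≤ r * ‖ω‖ := by
  refine le_of_sq_le_sq ?_ (by positivity)
  rw [← re_inner_star_mul_self_mul hω, ← re_inner_smul_apply r hω]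
  exact re_inner_le_re_inner_of_le h ω

theorem mul_norm_le_norm_apply (h : r ^ 2 • q ≤ star d * d * q) (hω : q ω = ω) :
    r * ‖ω‖ ≤ ‖d ω‖ := by
  refine le_of_sq_le_sq ?_ (norm_nonneg _)
  rw [← re_inner_star_mul_self_mul hω, ← re_inner_smul_apply r hω]
  exact re_inner_le_re_inner_of_le h ω

theorem norm_le_two_mul_norm_sub_of_star_mul_mul_le (hq : IsStarProjection q) (hdq : Commute d q)
    (h : star d * d * q ≤ (1 / 2 : ℝ) ^ 2 • q) (ξ : H) : ‖q ξ‖ ≤ 2 * ‖ξ - d ξ‖ := by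
  have hqξ : q (q ξ) = q ξ := congr($(hq.isIdempotentElem.eq) ξ)
  have hdqξ : d (q ξ) = q (d ξ) := congr($(hdq.eq) ξ)
  have h₁ : ‖q ξ - d (q ξ)‖ ≤ ‖ξ - d ξ‖ := by
    rw [hdqξ, ← map_sub]
    exact (q.le_of_opNorm_le hq.norm_le _).trans_eq (one_mul _)
  have h₂ : ‖d (q ξ)‖ ≤ 1 / 2 * ‖q ξ‖ := norm_apply_le_mul_norm (by norm_num) h hqξ
  linarith [norm_sub_norm_le (q ξ) (d (q ξ))]

theorem norm_le_two_mul_norm_of_le_star_mul_mul (hq : IsStarProjection q) (hdq : Commute d q)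
    (h : (1 / 2 : ℝ) ^ 2 • q ≤ star d * d * q) (η : H) : ‖q η‖ ≤ 2 * ‖d η‖ := by
  have hqη : q (q η) = q η := congr($(hq.isIdempotentElem.eq) η)
  have hdqη : d (q η) = q (d η) := congr($(hdq.eq) η)
  have h₁ : 1 / 2 * ‖q η‖ ≤ ‖d (q η)‖ := mul_norm_le_norm_apply h hqη
  have h₂ : ‖q (d η)‖ ≤ ‖d η‖ := (q.le_of_opNorm_le hq.norm_le _).trans_eq (one_mul _)
  rw [hdqη] at h₁
  linarith

end SpectralEstimate

variable {B : StarSubalgebra ℂ (H →L[ℂ] H)}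

/-- The bicommutant of a `*`-algebra of operators. -/
noncomputable def bicommutant (B : StarSubalgebra ℂ (H →L[ℂ] H)) : VonNeumannAlgebra H where
  toStarSubalgebra := StarSubalgebra.centralizer ℂ
    (StarSubalgebra.centralizer ℂ (B : Set (H →L[ℂ] H)) : Set (H →L[ℂ] H))
  centralizer_centralizer' := by simp

theorem coe_bicommutant : (bicommutant B : Set (H →L[ℂ] H)) =
    Set.centralizer (Set.centralizer (B : Set (H →L[ℂ] H))) := by
  change ((StarSubalgebra.centralizer ℂ
    (StarSubalgebra.centralizer ℂ (B : Set (H →L[ℂ] H)) : Set (H →L[ℂ] H)) :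
      StarSubalgebra ℂ (H →L[ℂ] H)) : Set (H →L[ℂ] H)) = _
  rw [StarSubalgebra.coe_centralizer, StarMemClass.star_coe_eq, Set.union_self,
    StarSubalgebra.coe_centralizer, StarMemClass.star_coe_eq, Set.union_self]

theorem commute_of_mem_bicommutant {S T : H →L[ℂ] H} (hT : T ∈ bicommutant B)
    (hS : S ∈ Set.centralizer (B : Set (H →L[ℂ] H))) : Commute S T := by
  rw [← SetLike.mem_coe, coe_bicommutant] at hT
  exact hT S hS

theorem exists_norm_sub_lt_of_mem_bicommutant {T : H →L[ℂ] H} (hT : T ∈ bicommutant B) (ζ : H)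
    {ε : ℝ} (hε : 0 < ε) : ∃ d ∈ B, ‖T ζ - d ζ‖ < ε := by
  let V : Submodule ℂ H := (Subalgebra.toSubmodule B.toSubalgebra).map
    (ContinuousLinearMap.apply ℂ H ζ).toLinearMap
  let P := V.topologicalClosure.starProjection
  have invariant {S : H →L[ℂ] H} (hS : S ∈ B) : P * (S * P) = S * P := by
    have hSV : ∀ ξ ∈ V.topologicalClosure, S ξ ∈ V.topologicalClosure := fun ξ hξ => by
      refine map_mem_closure S.continuous hξ ?_
      rintro _ ⟨d, hd, rfl⟩
      exact ⟨S * d, B.mul_mem hS hd, rfl⟩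
    exact ContinuousLinearMap.ext fun ξ => Submodule.starProjection_eq_self_iff.2 <|
      hSV _ (Submodule.starProjection_apply_mem _ ξ)
  have hP : P ∈ Set.centralizer (B : Set (H →L[ℂ] H)) := fun S hS =>
    commute_of_mul_mul_eq_mul isStarProjection_starProjection (invariant hS)
      (invariant (star_mem hS))
  have hζ : ζ ∈ V.topologicalClosure := V.le_topologicalClosure ⟨1, one_mem B, rfl⟩
  have hTζ : T ζ ∈ V.topologicalClosure :=
    apply_mem_of_commute_starProjection (commute_of_mem_bicommutant hT hP).symm hζ
  obtain ⟨_, ⟨d, hd, rfl⟩, h⟩ := Metric.mem_closure_iff.1 hTζ ε hε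
  exact ⟨d, hd, by rwa [dist_eq_norm] at h⟩

theorem commute_of_mem_of_mem_bicommutant (hcomm : ∀ S ∈ B, ∀ T ∈ B, S * T = T * S)
    {S T : H →L[ℂ] H} (hS : S ∈ B) (hT : T ∈ bicommutant B) : Commute S T :=
  commute_of_mem_bicommutant hT fun U hU => hcomm U hU S hS

theorem exists_mem_separating (hcomm : ∀ S ∈ B, ∀ T ∈ B, S * T = T * S)
    {P : H →L[ℂ] H} (hP : IsStarProjection P) (hPB : P ∈ bicommutant B) {ξ η : H} (hξ : P ξ = ξ)
    (hη : P η = 0) {ε : ℝ} (hε : 0 < ε) : ∃ d ∈ B, ‖ξ - d ξ‖ < ε ∧ ‖d η‖ < ε := by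
  obtain ⟨d, hd, h⟩ := exists_norm_sub_lt_of_mem_bicommutant hPB (ξ + η) hε
  have hdP (ω : H) : d (P ω) = P (d ω) :=
    congr($((commute_of_mem_of_mem_bicommutant hcomm hd hPB).eq) ω)
  have norm_le {q : H →L[ℂ] H} (hq : IsStarProjection q) :
      ‖q (P (ξ + η) - d (ξ + η))‖ < ε :=
    ((q.le_of_opNorm_le hq.norm_le _).trans_eq (one_mul _)).trans_lt h
  have hdξ : P (d ξ) = d ξ := by rw [← hdP, hξ]
  have hdη : P (d η) = 0 := by rw [← hdP, hη, map_zero]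
  refine ⟨d, hd, ?_, ?_⟩
  · simpa [hξ, hη, hdξ, hdη] using norm_le hP
  · simpa [hξ, hη, hdξ, hdη] using norm_le hP.one_sub

section AnnihilatorClosed

variable (hB : IsAnnihilatorClosed B) (hcl : IsClosed (B : Set (H →L[ℂ] H)))
  (hcomm : ∀ S ∈ B, ∀ T ∈ B, S * T = T * S)

include hB hcl hcomm

theorem exists_starProjection_mem_separating {P : H →L[ℂ] H} (hP : IsStarProjection P)
    (hPB : P ∈ bicommutant B) {ξ η : H} (hξ : P ξ = ξ) (hη : P η = 0) {ε : ℝ} (hε : 0 < ε) :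
    ∃ D : ClosedSubmodule ℂ H, D.starProjection ∈ B ∧ ‖D.starProjection ξ‖ ≤ ε ∧
      ‖η - D.starProjection η‖ ≤ ε := by
  obtain ⟨d, hd, hdξ, hdη⟩ := exists_mem_separating hcomm hP hPB hξ hη (half_pos hε)
  have hs := isSpectralResolution_spectralProjection (star d * d)
  have hsep := hs.separatesWithin_zero (.star_mul_self d)
  have hpB : spectralProjection (star d * d) (1 / 4) ∈ B :=
    hB.spectralProjection_mem hcl (mul_mem (star_mem hd) hd) _
  have hdp : Commute d (spectralProjection (star d * d) (1 / 4)) := hcomm d hd _ hpB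
  refine ⟨spectralSubspace (star d * d) (1 / 4), ?_⟩
  rw [← spectralProjection_eq]
  refine ⟨hpB, ?_, ?_⟩
  · have := norm_le_two_mul_norm_sub_of_star_mul_mul_le (hs.isStarProjection _) hdp
      ((hsep.mul_le (1 / 4)).trans_eq (by norm_num)) ξ
    linarith
  · have := norm_le_two_mul_norm_of_le_star_mul_mul (hs.isStarProjection _).one_sub
      ((Commute.one_right d).sub_right hdp) (le_trans (by norm_num) (hsep.le_mul (1 / 4))) η
    rw [sub_apply, one_apply_eq_self] at this
    linarith

theorem eq_zero_of_forall_apply_eq_zero {P : H →L[ℂ] H} (hP : IsStarProjection P)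
    (hPB : P ∈ bicommutant B) {ξ η : H} (hξ : P ξ = ξ) (hη : P η = 0)
    (hξη : ∀ b ∈ B, b ξ = 0 → b η = 0) : η = 0 := by
  suffices h : ∀ δ > 0, ‖η‖ / 2 ≤ 0 + δ by
    exact norm_le_zero_iff.1 (by linarith [le_of_forall_pos_le_add h])
  intro δ hδ
  have hsum := summable_geometric_two' δ
  choose D hDB hDξ hDη using fun n : ℕ =>
    exists_starProjection_mem_separating hB hcl hcomm hP hPB hξ hη (ε := δ / 2 / 2 ^ n)
      (by positivity)
  have hηsum : Summable fun n => ‖η - (D n).starProjection η‖ :=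
    .of_nonneg_of_le (fun _ => norm_nonneg _) hDη hsum
  obtain ⟨w, hw, hdist⟩ := exists_mem_iInf_dist_le (fun m n => hcomm _ (hDB m) _ (hDB n)) hηsum
  have hηw : ‖η - w‖ ≤ δ := by
    rw [← dist_eq_norm, ← tsum_geometric_two' δ]
    exact hdist.trans (hηsum.tsum_le_tsum hDη hsum)
  have hEη : (⨅ n, D n).starProjection η = 0 :=
    hξη _ (hB.starProjection_iInf_mem hDB) <| starProjection_iInf_apply_eq_zero <|
      squeeze_zero_norm hDξ hsum.tendsto_atTop_zero
  have hEw : (⨅ n, D n).starProjection w = w := Submodule.starProjection_eq_self_iff.2 hw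
  have hwη : ‖w‖ ≤ ‖η - w‖ := by
    have h := Submodule.norm_starProjection_apply_le (⨅ n, D n).toSubmodule (η - w)
    rwa [map_sub, hEη, hEw, zero_sub, norm_neg] at h
  linarith [norm_le_norm_sub_add η w]

theorem starProjection_mem_of_mem_bicommutant {K : ClosedSubmodule ℂ H}
    (hK : K.starProjection ∈ bicommutant B) : K.starProjection ∈ B := by
  have hKL : K = ⨆ ξ : K, commonKernel {b | b ∈ B ∧ b ξ = 0} := by
    refine le_antisymm (fun ξ hξ => ?_) (iSup_le fun ξ ω hω => ?_)
    · have hle := le_iSup (fun ξ : K => commonKernel {b | b ∈ B ∧ b (ξ : H) = 0}) ⟨ξ, hξ⟩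
      exact hle (mem_commonKernel.2 fun b hb => hb.2)
    have hKξ : K.starProjection ξ = ξ := Submodule.starProjection_eq_self_iff.2 ξ.2
    have hKω : K.starProjection (ω - K.starProjection ω) = 0 := by
      rw [map_sub, Submodule.starProjection_eq_self_iff.2 (Submodule.starProjection_apply_mem _ ω),
        sub_self]
    have hω0 : ω - K.starProjection ω = 0 := by
      refine eq_zero_of_forall_apply_eq_zero hB hcl hcomm isStarProjection_starProjection hK hKξ
        hKω fun b hb hbξ => ?_
      have hbK : b (K.starProjection ω) = K.starProjection (b ω) :=
        congr($((commute_of_mem_of_mem_bicommutant hcomm hb hK).eq) ω)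
      rw [map_sub, hbK, mem_commonKernel.1 hω b ⟨hb, hbξ⟩, map_zero, sub_zero]
    exact Submodule.starProjection_eq_self_iff.1 (sub_eq_zero.1 hω0).symm
  rw [hKL]
  exact hB.starProjection_iSup_mem fun ξ => hB _ fun b hb => hb.1

theorem centralizer_centralizer_eq :
    Set.centralizer (Set.centralizer (B : Set (H →L[ℂ] H))) = B := by
  have mem_of_isSelfAdjoint {a : H →L[ℂ] H} (ha : IsSelfAdjoint a) (haB : a ∈ bicommutant B) :
      a ∈ B :=
    mem_of_forall_spectralProjection_mem hcl ha fun x => by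
      have h := spectralProjection_mem_vonNeumannAlgebra haB x
      rw [spectralProjection_eq] at h ⊢
      exact starProjection_mem_of_mem_bicommutant hB hcl hcomm h
  refine Set.Subset.antisymm (fun T hT => ?_) Set.subset_centralizer_centralizer
  rw [← coe_bicommutant] at hT
  have hT' : T ∈ (bicommutant B).toStarSubalgebra := hT
  have hTstar : star T ∈ (bicommutant B).toStarSubalgebra := star_mem hT'
  rw [← realPart_add_I_smul_imaginaryPart T]
  refine add_mem (mem_of_isSelfAdjoint (realPart T).2 ?_)
    (B.smul_mem (mem_of_isSelfAdjoint (imaginaryPart T).2 ?_) _)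
  · rw [realPart_apply_coe, RCLike.real_smul_eq_coe_smul (K := ℂ)]
    exact (bicommutant B).toStarSubalgebra.smul_mem (add_mem hT' hTstar) _
  · rw [imaginaryPart_apply_coe, RCLike.real_smul_eq_coe_smul (K := ℂ)]
    exact (bicommutant B).toStarSubalgebra.smul_mem
      ((bicommutant B).toStarSubalgebra.smul_mem (sub_mem hT' hTstar) _) _

end AnnihilatorClosed

end Bicommutant

section Automorphism

namespace IsSpectralResolution

variable {𝒜 ℬ : Type*} [CStarAlgebra 𝒜] [CStarAlgebra ℬ] {a : 𝒜}

theorem eq {p q : ℝ → 𝒜} (hp : IsSpectralResolution a p) (hq : IsSpectralResolution a q) : p = q :=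
  funext fun x => (hp x).eq (hq x)

theorem of_map_injective {f : 𝒜 →⋆ₐ[ℂ] ℬ} (hf : Function.Injective f) (ha : IsSelfAdjoint a)
    {p : ℝ → 𝒜} (hp : IsSpectralResolution (f a) fun x => f (p x)) : IsSpectralResolution a p :=
  fun x => .of_map_injective hf <| by
    have hf' : Continuous f := (NonUnitalStarAlgHom.isometry f hf).continuous
    rw [Set.image_singleton, StarAlgHomClass.map_cfc (S := ℂ) f _ a]
    exact hp x

theorem map (e : 𝒜 ≃⋆ₐ[ℂ] ℬ) (ha : IsSelfAdjoint a) {p : ℝ → 𝒜} (hp : IsSpectralResolution a p) :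
    IsSpectralResolution (e a) fun x => e (p x) := fun x => by
  have he : Continuous e := (StarAlgEquiv.isometry e).continuous
  have h := (hp x).map e
  rwa [Set.image_singleton, StarAlgHomClass.map_cfc (S := ℂ) e _ a] at h

end IsSpectralResolution

variable {H : Type*} [NormedAddCommGroup H] [InnerProductSpace ℂ H] [CompleteSpace H]

noncomputable instance (A : VonNeumannAlgebra H) : CStarAlgebra A.toStarSubalgebra :=
  have : IsClosed (A.toStarSubalgebra : Set (H →L[ℂ] H)) := isClosed_vonNeumannAlgebra A
  StarSubalgebra.cstarAlgebra A.toStarSubalgebra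

variable {A : VonNeumannAlgebra H} (h : A.toStarSubalgebra ≃⋆ₐ[ℂ] A.toStarSubalgebra)

namespace SelfAdjointPart

/-- The spectral resolution of `a`, with values in `A` so that automorphisms of `A` act on it. -/
noncomputable def resolution (a : SelfAdjointPart A) (x : ℝ) : A.toStarSubalgebra :=
  ⟨spectralProjection a.val x, spectralProjection_mem_vonNeumannAlgebra a.mem x⟩

theorem isSpectralResolution_resolution (a : SelfAdjointPart A) :
    IsSpectralResolution (⟨a.val, a.mem⟩ : A.toStarSubalgebra) a.resolution := by
  have hsa : IsSelfAdjoint (⟨a.val, a.mem⟩ : A.toStarSubalgebra) := Subtype.ext a.isSelfAdjoint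
  have hinj : Function.Injective A.toStarSubalgebra.subtype := Subtype.val_injective
  exact .of_map_injective hinj hsa (isSpectralResolution_spectralProjection a.val)

theorem resolution_map (a : SelfAdjointPart A) (x : ℝ) :
    (a.map h).resolution x = h (a.resolution x) := by
  have hmap : IsSpectralResolution (h ⟨a.val, a.mem⟩) (a.map h).resolution :=
    (a.map h).isSpectralResolution_resolution
  have ha : IsSelfAdjoint (⟨a.val, a.mem⟩ : A.toStarSubalgebra) := Subtype.ext a.isSelfAdjoint
  exact congr_fun (hmap.eq (a.isSpectralResolution_resolution.map h ha)) x

theorem le_iff_resolution {a b : SelfAdjointPart A} :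
    a ≤ b ↔ ∀ x, a.resolution x * b.resolution x = b.resolution x := by
  refine forall_congr' fun x => ?_
  rw [IsStarProjection.le_iff_mul_eq_right
    ((isSpectralResolution_spectralProjection b.val).isStarProjection x)
    ((isSpectralResolution_spectralProjection a.val).isStarProjection x), Subtype.ext_iff]
  rfl

theorem map_le_map_iff {a b : SelfAdjointPart A} : a.map h ≤ b.map h ↔ a ≤ b := by
  simp only [le_iff_resolution, resolution_map, ← map_mul, (EquivLike.injective h).eq_iff]

theorem map_map_symm (a : SelfAdjointPart A) : (a.map h.symm).map h = a :=
  SelfAdjointPart.ext (congr_arg Subtype.val (h.apply_symm_apply ⟨a.val, a.mem⟩))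

/-- A `*`-automorphism of `A`, as an automorphism of `A_sa` with its spectral order. -/
noncomputable def mapOrderIso : SelfAdjointPart A ≃o SelfAdjointPart A where
  toFun := map h
  invFun := map h.symm
  left_inv := map_map_symm h.symm
  right_inv := map_map_symm h
  map_rel_iff' := map_le_map_iff h

end SelfAdjointPart

namespace Context

variable (C : Context A)

/-- The image `h[C]`, as a `*`-algebra of operators. -/
noncomputable def imageStarSubalgebra : StarSubalgebra ℂ (H →L[ℂ] H) :=
  ((C.algebra.toStarSubalgebra.comap A.toStarSubalgebra.subtype).map
    (h : A.toStarSubalgebra →⋆ₐ[ℂ] A.toStarSubalgebra)).map A.toStarSubalgebra.subtype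

theorem mem_imageStarSubalgebra_iff {y : H →L[ℂ] H} :
    y ∈ C.imageStarSubalgebra h ↔
      ∃ c : A.toStarSubalgebra, (c : H →L[ℂ] H) ∈ C.algebra ∧ (h c : H →L[ℂ] H) = y := by
  constructor
  · rintro ⟨_, ⟨c, hc, rfl⟩, rfl⟩
    exact ⟨c, hc, rfl⟩
  · rintro ⟨c, hc, rfl⟩
    exact ⟨_, ⟨c, hc, rfl⟩, rfl⟩

theorem coe_map_mem_imageStarSubalgebra_iff {c : A.toStarSubalgebra} :
    (h c : H →L[ℂ] H) ∈ C.imageStarSubalgebra h ↔ (c : H →L[ℂ] H) ∈ C.algebra := by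
  rw [mem_imageStarSubalgebra_iff]
  refine ⟨?_, fun hc => ⟨c, hc, rfl⟩⟩
  rintro ⟨d, hd, hdc⟩
  exact EquivLike.injective h (Subtype.ext hdc) ▸ hd

theorem isClosed_imageStarSubalgebra : IsClosed (C.imageStarSubalgebra h : Set (H →L[ℂ] H)) := by
  have hisom : Isometry fun c : A.toStarSubalgebra => (h c : H →L[ℂ] H) :=
    isometry_subtype_coe.comp (StarAlgEquiv.isometry h)
  have hC : IsClosed {c : A.toStarSubalgebra | (c : H →L[ℂ] H) ∈ C.algebra} :=
    (isClosed_vonNeumannAlgebra C.algebra).preimage continuous_subtype_val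
  have himage : (C.imageStarSubalgebra h : Set (H →L[ℂ] H)) =
      (fun c => (h c : H →L[ℂ] H)) '' {c | (c : H →L[ℂ] H) ∈ C.algebra} :=
    Set.ext fun _ => C.mem_imageStarSubalgebra_iff h
  exact himage ▸ hisom.isClosedEmbedding.isClosedMap _ hC

theorem imageStarSubalgebra_comm :
    ∀ S ∈ C.imageStarSubalgebra h, ∀ T ∈ C.imageStarSubalgebra h, S * T = T * S := by
  intro S hS T hT
  obtain ⟨c, hc, rfl⟩ := (C.mem_imageStarSubalgebra_iff h).1 hS
  obtain ⟨d, hd, rfl⟩ := (C.mem_imageStarSubalgebra_iff h).1 hT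
  have hcd : Commute c d := Subtype.ext (C.comm _ hc _ hd)
  exact congr_arg Subtype.val (hcd.map h).eq

theorem isAnnihilatorClosed_imageStarSubalgebra :
    IsAnnihilatorClosed (C.imageStarSubalgebra h) := by
  intro s hs
  let s₀ : Set A.toStarSubalgebra := {c | (h c : H →L[ℂ] H) ∈ s}
  have hs₀ : A.toStarSubalgebra.subtype '' (h '' s₀) = s := by
    refine Set.Subset.antisymm ?_ fun y hy => ?_
    · rintro _ ⟨_, ⟨c, hc, rfl⟩, rfl⟩
      exact hc
    · obtain ⟨c, -, rfl⟩ := (C.mem_imageStarSubalgebra_iff h).1 (hs hy)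
      exact ⟨_, ⟨c, hy, rfl⟩, rfl⟩
  have hC : (commonKernel (A.toStarSubalgebra.subtype '' s₀)).starProjection ∈ C.algebra := by
    refine isAnnihilatorClosed_vonNeumannAlgebra C.algebra _ ?_
    rintro _ ⟨c, hc, rfl⟩
    exact (C.coe_map_mem_imageStarSubalgebra_iff h).1 (hs hc)
  have hA : (commonKernel (A.toStarSubalgebra.subtype '' (h '' s₀))).starProjection ∈ A :=
    isAnnihilatorClosed_vonNeumannAlgebra A _ (by rintro _ ⟨c, -, rfl⟩; exact c.2)
  have hmap := ((isAnnihilatorProjection_mk_commonKernel (C.le hC)).map h).eq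
    (isAnnihilatorProjection_mk_commonKernel hA)
  rw [← hs₀]
  exact (C.mem_imageStarSubalgebra_iff h).2 ⟨_, hC, congr_arg Subtype.val hmap⟩

/-- The image `h[C]` of a context under a `*`-automorphism, which is again a context. -/
noncomputable def image : Context A where
  algebra :=
    { toStarSubalgebra := C.imageStarSubalgebra h
      centralizer_centralizer' := centralizer_centralizer_eq
        (C.isAnnihilatorClosed_imageStarSubalgebra h) (C.isClosed_imageStarSubalgebra h)
        (C.imageStarSubalgebra_comm h) }
  le y hy := by
    obtain ⟨c, -, rfl⟩ := (C.mem_imageStarSubalgebra_iff h).1 hy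
    exact (h c).2
  comm := C.imageStarSubalgebra_comm h

theorem coe_image : ((C.image h).algebra : Set (H →L[ℂ] H)) =
    {y | ∃ c : A.toStarSubalgebra, (c : H →L[ℂ] H) ∈ C.algebra ∧ (h c : H →L[ℂ] H) = y} :=
  Set.ext fun _ => C.mem_imageStarSubalgebra_iff h

variable (a : SelfAdjointPart A)

theorem above_map : (C.image h).above (a.map h) = SelfAdjointPart.mapOrderIso h '' C.above a := by
  ext b
  obtain ⟨b, rfl⟩ := (SelfAdjointPart.mapOrderIso h).surjective b
  rw [(SelfAdjointPart.mapOrderIso h).injective.mem_set_image]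
  exact and_congr (C.coe_map_mem_imageStarSubalgebra_iff h) (SelfAdjointPart.map_le_map_iff h)

theorem below_map : (C.image h).below (a.map h) = SelfAdjointPart.mapOrderIso h '' C.below a := by
  ext b
  obtain ⟨b, rfl⟩ := (SelfAdjointPart.mapOrderIso h).surjective b
  rw [(SelfAdjointPart.mapOrderIso h).injective.mem_set_image]
  exact and_congr (C.coe_map_mem_imageStarSubalgebra_iff h) (SelfAdjointPart.map_le_map_iff h)

theorem map_outerDaseinisation :
    (outerDaseinisation a C).map h = outerDaseinisation (a.map h) (C.image h) := by
  refine IsGLB.unique ?_ ((C.image h).isGLB_outerDaseinisation (a.map h))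
  rw [above_map]
  exact (SelfAdjointPart.mapOrderIso h).isGLB_image'.2 (C.isGLB_outerDaseinisation a)

theorem map_innerDaseinisation :
    (innerDaseinisation a C).map h = innerDaseinisation (a.map h) (C.image h) := by
  refine IsLUB.unique ?_ ((C.image h).isLUB_innerDaseinisation (a.map h))
  rw [below_map]
  exact (SelfAdjointPart.mapOrderIso h).isLUB_image'.2 (C.isLUB_innerDaseinisation a)

end Context

end Automorphism

theorem corollary5p16 {H : Type*} [NormedAddCommGroup H] [InnerProductSpace ℂ H]
    [CompleteSpace H] (A : VonNeumannAlgebra H)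
    (h : A.toStarSubalgebra ≃⋆ₐ[ℂ] A.toStarSubalgebra)
    (a : SelfAdjointPart A) (C : Context A) :
    -- the image `h[C]` is again a context `D`
    ∃ D : Context A,
      (D.algebra : Set (H →L[ℂ] H)) =
        {y | ∃ c : A.toStarSubalgebra, (c : H →L[ℂ] H) ∈ C.algebra ∧ (h c : H →L[ℂ] H) = y} ∧
      -- the meets and joins that define the daseinisations exist, and lie in the context
      (IsGLB (C.above a) (outerDaseinisation a C) ∧
        (outerDaseinisation a C).val ∈ C.algebra) ∧
      (IsGLB (D.above (a.map h)) (outerDaseinisation (a.map h) D) ∧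
        (outerDaseinisation (a.map h) D).val ∈ D.algebra) ∧
      (IsLUB (C.below a) (innerDaseinisation a C) ∧
        (innerDaseinisation a C).val ∈ C.algebra) ∧
      (IsLUB (D.below (a.map h)) (innerDaseinisation (a.map h) D) ∧
        (innerDaseinisation (a.map h) D).val ∈ D.algebra) ∧
      -- the two identities
      (outerDaseinisation a C).map h = outerDaseinisation (a.map h) D ∧
      (innerDaseinisation a C).map h = innerDaseinisation (a.map h) D :=
  ⟨C.image h, C.coe_image h,
    ⟨C.isGLB_outerDaseinisation a, C.outerDaseinisation_mem a⟩,
    ⟨(C.image h).isGLB_outerDaseinisation _, (C.image h).outerDaseinisation_mem _⟩,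
    ⟨C.isLUB_innerDaseinisation a, C.innerDaseinisation_mem a⟩,
    ⟨(C.image h).isLUB_innerDaseinisation _, (C.image h).innerDaseinisation_mem _⟩,
    C.map_outerDaseinisation h a, C.map_innerDaseinisation h a⟩
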